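/- An $L_2$-structure consists of a set $N$ of numbers with $0,1,+,\cdot,<$ (possibly nonstandard) and a nonempty family $S$ of subsets of $N$ over which the set variables range. Its axiom systems are the usual ones: $\mathsf{RCA}_0$ consists of the basic axioms of arithmetic, $\Sigma^0_1$ induction and $\Delta^0_1$ comprehension (with number and set parameters), and $\mathsf{ACA}_0$ consists of the basic axioms, the set induction axiom and arithmetical comprehension. Finite subsets of a set $M$ are represented by their standard codes: with $(i,j)=(i+j)^2+i$, the code of a finite set $X$ is the least number of the form $(k,(m,n))$ such that, for all $i$, $i\in X$ if and only if $i<k$ and $m(i+1)+1$ divides $n$. Let $M^{<\mathbb N}$ be the set of codes of finite subsets of $M$. Functions are sets of coded pairs, and $|X|<|Y|$ means that for some numbers $m<n$ there are bijections from $\{i:i<m\}$ to $X$ and from $\{i:i<n\}$ to $Y$. An e-matroid is a pair $(M,e)$ of a set $M$ and a function $e\colon\mathbb N\to M^{<\mathbb N}$ such that 1. $e(n)\neq\emptyset$ for all $n$; 2. for all $n$ and all $Y\in M^{<\mathbb N}$, if $e(n)\subseteq Y$ then $e(m)=Y$ for some $m$; 3. for all $X,Y\in M^{<\mathbb N}$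 with $|X|<|Y|$, neither of them a value of $e$, there is $y\in Y$ (possibly $y\in X$) such that $X\cup\{y\}$ is not a value of $e$. A matroid is a pair $(M,D)$ of sets with $D\subseteq M^{<\mathbb N}$ that satisfies the same three conditions with "is a value of $e$" replaced by "is an element of $D$" (so $D$ is the set of finite dependent sets). **Theorem.** Over $\mathsf{RCA}_0$, the following are equivalent: 1. $\mathsf{ACA}_0$. 2. Every e-matroid is isomorphic to a matroid. That is, if $(M,e)$ is an e-matroid, then there are a matroid $(M',D)$ and a bijection $h\colon M\to M'$ such that for every finite set $X\subseteq M$, there is an $n$ with $e(n)=X$ if and only if $\{h(x):x\in X\}\in D$. Here "over $\mathsf{RCA}_0$" means that every $L_2$-structure satisfying $\mathsf{RCA}_0$ satisfies (1) if and only if it satisfies (2), where all sets and functions in (2) and in the definitions above are members of $S$ and all numbers are members of $N$. -/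

import Mathlib

universe u

namespace SOA

/-! Second-order arithmetic.  An `L₂`-structure is a type `N` of numbers with `0, 1, +, *, <`
(possibly nonstandard) together with a nonempty family `S` of subsets of `N`, over which the set
variables range.  A sentence is provable in a theory iff it holds in all such structures that
satisfy the theory. -/

/-- Numerical terms of `L₂`; number variables are indexed by `ℕ`. -/
inductive Term : Type
  | var (x : ℕ) : Term
  | zero : Term
  | one : Term
  | add (s t : Term) : Term
  | mul (s t : Term) : Term

/-- The variable `x` occurs in a term. -/
def Term.Occurs (x : ℕ) : Term → Prop
  | .var y => x = y
  | .zero => False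
  | .one => False
  | .add s t => s.Occurs x ∨ t.Occurs x
  | .mul s t => s.Occurs x ∨ t.Occurs x

/-- The arithmetical formulas of `L₂`: quantifiers range over numbers only, while free set
variables (indexed by `ℕ`) are allowed. -/
inductive ArithFormula : Type
  | eq (s t : Term) : ArithFormula
  | lt (s t : Term) : ArithFormula
  | mem (t : Term) (X : ℕ) : ArithFormula
  | neg (φ : ArithFormula) : ArithFormula
  | and (φ ψ : ArithFormula) : ArithFormula
  | or (φ ψ : ArithFormula) : ArithFormula
  | imp (φ ψ : ArithFormula) : ArithFormula
  | all (x : ℕ) (φ : ArithFormula) : ArithFormula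
  | ex (x : ℕ) (φ : ArithFormula) : ArithFormula

/-- `Σ⁰₀` formulas: all quantifiers are bounded, `∀ x < t` or `∃ x < t` with `x` not in `t`. -/
inductive IsBounded : ArithFormula → Prop
  | eq (s t : Term) : IsBounded (.eq s t)
  | lt (s t : Term) : IsBounded (.lt s t)
  | mem (t : Term) (X : ℕ) : IsBounded (.mem t X)
  | neg {φ : ArithFormula} : IsBounded φ → IsBounded (.neg φ)
  | and {φ ψ : ArithFormula} : IsBounded φ → IsBounded ψ → IsBounded (.and φ ψ)
  | or {φ ψ : ArithFormula} : IsBounded φ → IsBounded ψ → IsBounded (.or φ ψ)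
  | imp {φ ψ : ArithFormula} : IsBounded φ → IsBounded ψ → IsBounded (.imp φ ψ)
  | ball {φ : ArithFormula} (x : ℕ) (t : Term) : ¬ t.Occurs x → IsBounded φ →
      IsBounded (.all x (.imp (.lt (.var x) t) φ))
  | bex {φ : ArithFormula} (x : ℕ) (t : Term) : ¬ t.Occurs x → IsBounded φ →
      IsBounded (.ex x (.and (.lt (.var x) t) φ))

/-- `Σ⁰₁` formulas: `∃ x θ` with `θ` bounded. -/
def IsSigma1 (φ : ArithFormula) : Prop := ∃ x θ, IsBounded θ ∧ φ = .ex x θ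

/-- `Π⁰₁` formulas: `∀ x θ` with `θ` bounded. -/
def IsPi1 (φ : ArithFormula) : Prop := ∃ x θ, IsBounded θ ∧ φ = .all x θ

section

variable {N : Type u} [Zero N] [One N] [Add N] [Mul N] [LT N]

/-- Value of a term under an assignment `v` of the number variables. -/
def Term.eval (v : ℕ → N) : Term → N
  | .var x => v x
  | .zero => 0
  | .one => 1
  | .add s t => s.eval v + t.eval v
  | .mul s t => s.eval v * t.eval v

/-- Satisfaction under assignments `v` of the number variables and `V` of the set variables. -/
def ArithFormula.Sat (V : ℕ → Set N) : (ℕ → N) → ArithFormula → Prop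
  | v, .eq s t => s.eval v = t.eval v
  | v, .lt s t => s.eval v < t.eval v
  | v, .mem t X => t.eval v ∈ V X
  | v, .neg φ => ¬ φ.Sat V v
  | v, .and φ ψ => φ.Sat V v ∧ ψ.Sat V v
  | v, .or φ ψ => φ.Sat V v ∨ ψ.Sat V v
  | v, .imp φ ψ => φ.Sat V v → ψ.Sat V v
  | v, .all x φ => ∀ n : N, φ.Sat V (Function.update v x n)
  | v, .ex x φ => ∃ n : N, φ.Sat V (Function.update v x n)

variable (N) in
/-- The basic axioms of second-order arithmetic. -/
structure BasicAxioms : Prop where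
  succ_ne_zero : ∀ n : N, n + 1 ≠ 0
  succ_inj : ∀ m n : N, m + 1 = n + 1 → m = n
  add_zero : ∀ m : N, m + 0 = m
  add_succ : ∀ m n : N, m + (n + 1) = (m + n) + 1
  mul_zero : ∀ m : N, m * 0 = 0
  mul_succ : ∀ m n : N, m * (n + 1) = m * n + m
  not_lt_zero : ∀ m : N, ¬ m < 0
  lt_succ : ∀ m n : N, m < n + 1 ↔ (m < n ∨ m = n)

/-- The structure `(N, S)` satisfies `RCA₀`. -/
structure RCA0 (S : Set (Set N)) : Prop where
  basic : BasicAxioms N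
  sigma1_induction : ∀ φ : ArithFormula, IsSigma1 φ →
    ∀ (x : ℕ) (v : ℕ → N) (V : ℕ → Set N), (∀ i, V i ∈ S) →
      φ.Sat V (Function.update v x 0) →
      (∀ n : N, φ.Sat V (Function.update v x n) → φ.Sat V (Function.update v x (n + 1))) →
      ∀ n : N, φ.Sat V (Function.update v x n)
  delta1_comprehension : ∀ φ ψ : ArithFormula, IsSigma1 φ → IsPi1 ψ →
    ∀ (x : ℕ) (v : ℕ → N) (V : ℕ → Set N), (∀ i, V i ∈ S) →
      (∀ n : N, φ.Sat V (Function.update v x n) ↔ ψ.Sat V (Function.update v x n)) →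
      ∃ X ∈ S, ∀ n : N, n ∈ X ↔ φ.Sat V (Function.update v x n)

/-- The structure `(N, S)` satisfies `ACA₀`. -/
structure ACA0 (S : Set (Set N)) : Prop where
  basic : BasicAxioms N
  induction : ∀ X ∈ S, (0 : N) ∈ X → (∀ n : N, n ∈ X → n + 1 ∈ X) → ∀ n : N, n ∈ X
  arithmetical_comprehension : ∀ (φ : ArithFormula) (x : ℕ) (v : ℕ → N) (V : ℕ → Set N),
    (∀ i, V i ∈ S) → ∃ X ∈ S, ∀ n : N, n ∈ X ↔ φ.Sat V (Function.update v x n)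

/-! Notions internal to a structure `(N, S)`: all quantifiers below range over `N` or over `S`. -/

/-- The usual code `(i, j) = (i + j)² + i` of an ordered pair in second-order arithmetic. -/
def pair (i j : N) : N := (i + j) * (i + j) + i

/-- The number `c` has the form `(k, (m, n))`. -/
def IsTriple (c : N) : Prop := ∃ k m n : N, c = pair k (pair m n)

/-- The set described by `c = (k, (m, n))`: all `i < k` such that `m (i + 1) + 1` divides `n`. -/
def decode (c : N) : Set N :=
  {i | ∃ k m n : N, c = pair k (pair m n) ∧ i < k ∧ ∃ q : N, n = (m * (i + 1) + 1) * q}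

/-- `c` is the code of a finite set: the least triple describing that set. Thus every finite set
has exactly one code, and the code determines its characteristic function. -/
def IsFinCode (c : N) : Prop :=
  IsTriple c ∧ ∀ c' : N, IsTriple c' → decode c' = decode c → ¬ c' < c

/-- The set `M^{<ℕ}` of codes of finite subsets of `M`. -/
def finSubsets (M : Set N) : Set N := {c | IsFinCode c ∧ decode c ⊆ M}

/-- `f` is (the graph of) a function from `A` to `B`. -/
def IsFun (f A B : Set N) : Prop :=
  (∀ p ∈ f, ∃ i ∈ A, ∃ j ∈ B, p = pair i j) ∧ ∀ i ∈ A, ∃! j, pair i j ∈ f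

/-- `f` is (the graph of) a bijection from `A` to `B`. -/
def IsBij (f A B : Set N) : Prop :=
  IsFun f A B ∧ ∀ j ∈ B, ∃! i, pair i j ∈ f

/-- `A` has exactly `n` elements, as witnessed by a bijection in the structure. -/
def HasCard (S : Set (Set N)) (A : Set N) (n : N) : Prop :=
  ∃ f ∈ S, IsBij f {i | i < n} A

/-- `|A| < |B|`. -/
def CardLT (S : Set (Set N)) (A B : Set N) : Prop :=
  ∃ m n : N, HasCard S A m ∧ HasCard S B n ∧ m < n

/-- The matroid conditions on a collection `Dep` of (codes of) finite dependent subsets of `M`.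
`Dep` need not belong to `S`. In `exchange`, the element `a` is allowed to lie in `X`. -/
structure DependenceAxioms (S : Set (Set N)) (M Dep : Set N) : Prop where
  empty : ∀ c ∈ Dep, decode c ≠ ∅
  superset : ∀ c ∈ Dep, ∀ d ∈ finSubsets M, decode c ⊆ decode d → d ∈ Dep
  exchange : ∀ x ∈ finSubsets M, ∀ y ∈ finSubsets M, CardLT S (decode x) (decode y) →
    x ∉ Dep → y ∉ Dep → ∃ a ∈ decode y, ∀ z ∈ Dep, decode z ≠ decode x ∪ {a}

/-- `(M, e)` is an e-matroid of the structure: `e : ℕ → M^{<ℕ}` enumerates the dependent sets. -/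
structure IsEMatroid (S : Set (Set N)) (M e : Set N) : Prop where
  ground_mem : M ∈ S
  enum_mem : e ∈ S
  isFun : IsFun e Set.univ (finSubsets M)
  axioms : DependenceAxioms S M {c | ∃ n, pair n c ∈ e}

/-- `(M, D)` is a matroid of the structure, `D` being the set of its finite dependent sets. -/
structure IsMatroid (S : Set (Set N)) (M D : Set N) : Prop where
  ground_mem : M ∈ S
  dep_mem : D ∈ S
  subset : D ⊆ finSubsets M
  axioms : DependenceAxioms S M D

/-- `h` is an isomorphism from the e-matroid `(M, e)` to the matroid `(M', D)`: a bijection such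
that a finite `X ⊆ M` is a value of `e` iff `{h(x) : x ∈ X} ∈ D`. -/
def IsIso (M e M' D h : Set N) : Prop :=
  IsBij h M M' ∧ ∀ x ∈ finSubsets M,
    ((∃ n, pair n x ∈ e) ↔ ∃ d ∈ D, decode d = {b | ∃ a ∈ decode x, pair a b ∈ h})

/-- The structure satisfies: every e-matroid is isomorphic to a matroid. -/
def EveryEMatroidIsoMatroid (S : Set (Set N)) : Prop :=
  ∀ M ∈ S, ∀ e ∈ S, IsEMatroid S M e →
    ∃ M' ∈ S, ∃ D ∈ S, ∃ h ∈ S, IsMatroid S M' D ∧ IsIso M e M' D h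

end

end SOA

/-! Arithmetical comprehension applied to the range of `e` yields the dependent sets as a set `D`,
and the identity on `M` is then an isomorphism from `(M, e)` to the matroid `(M, D)`.

Conversely, let `A = {x | ∃ z, R x z}` with `R` bounded; if `A` is empty it is a set anyway.
Otherwise declare a finite set dependent iff it meets `A`, so that the elements of `A` are loops and
nothing else is dependent. These sets are enumerable from witnesses `z`, so they form an e-matroid
on all of `N` (`RCA0.exists_eMatroid`). Given an isomorphism `h` to a matroid with dependent sets
`D`, one has `n ∈ A` iff `{n}` is a value of `e` iff `{h(n)} ∈ D`. The last condition has a Π⁰₁ form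
because `h(n)` and the code of `{h(n)}` are unique. Hence `A` is Δ⁰₁ and belongs to `S`
(`RCA0.sigmaComprehension`). Σ⁰₁ comprehension then removes unbounded quantifiers one at a time from
any arithmetical formula (`RCA0.bd_ex`, `RCA0.bd_sat`), which gives `ACA0`.

Definability is handled semantically, by the closure properties of `BD`; `BD.exists_formula` returns
to formulas. -/

namespace SOA

set_option linter.unusedSectionVars false

/-! ### Bounded definability with parameters, and its translation into formulas -/

section Definability

variable {N : Type u} [Zero N] [One N] [Add N] [Mul N] [LT N]

/-- Polynomial functions of `k` number variables, with coefficients in `N`. -/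
inductive TF [Add N] [Mul N] : (k : ℕ) → ((Fin k → N) → N) → Prop
  | const {k : ℕ} (c : N) : TF k fun _ => c
  | proj {k : ℕ} (i : Fin k) : TF k fun v => v i
  | add {k : ℕ} {f g : (Fin k → N) → N} : TF k f → TF k g → TF k fun v => f v + g v
  | mul {k : ℕ} {f g : (Fin k → N) → N} : TF k f → TF k g → TF k fun v => f v * g v

/-- Relations in `k` number variables that are definable by a bounded formula with number
parameters, and set parameters from `S`.  Variable `0` is the innermost one. -/
inductive BD [Add N] [Mul N] [LT N] (S : Set (Set N)) : (k : ℕ) → ((Fin k → N) → Prop) → Prop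
  | eq {k : ℕ} {f g : (Fin k → N) → N} : TF k f → TF k g → BD S k fun v => f v = g v
  | lt {k : ℕ} {f g : (Fin k → N) → N} : TF k f → TF k g → BD S k fun v => f v < g v
  | mem {k : ℕ} {f : (Fin k → N) → N} {X : Set N} : X ∈ S → TF k f → BD S k fun v => f v ∈ X
  | not {k : ℕ} {P : (Fin k → N) → Prop} : BD S k P → BD S k fun v => ¬ P v
  | and {k : ℕ} {P Q : (Fin k → N) → Prop} : BD S k P → BD S k Q → BD S k fun v => P v ∧ Q v
  | bex_cons {k : ℕ} {f : (Fin k → N) → N} {Q : (Fin (k + 1) → N) → Prop} : TF k f →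
      BD S (k + 1) Q → BD S k fun v => ∃ n, n < f v ∧ Q (Fin.cons n v)

theorem TF.comp {k l : ℕ} {f : (Fin k → N) → N} (hf : TF k f) {g : Fin k → (Fin l → N) → N}
    (hg : ∀ i, TF l (g i)) : TF l fun v => f fun i => g i v := by
  induction hf with
  | const c => exact .const c
  | proj i => exact hg i
  | add _ _ h₁ h₂ => exact h₁.add h₂
  | mul _ _ h₁ h₂ => exact h₁.mul h₂

theorem TF.weaken {k : ℕ} {f : (Fin k → N) → N} (hf : TF k f) :
    TF (k + 1) fun w => f (Fin.tail w) :=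
  hf.comp fun i => .proj i.succ

variable {S : Set (Set N)}

theorem BD.congr {k : ℕ} {P Q : (Fin k → N) → Prop} (hP : BD S k P) (h : ∀ v, Q v ↔ P v) :
    BD S k Q := by
  rwa [show Q = P from funext fun v => propext (h v)]

theorem BD.or {k : ℕ} {P Q : (Fin k → N) → Prop} (hP : BD S k P) (hQ : BD S k Q) :
    BD S k fun v => P v ∨ Q v :=
  (hP.not.and hQ.not).not.congr fun v => by tauto

theorem BD.imp {k : ℕ} {P Q : (Fin k → N) → Prop} (hP : BD S k P) (hQ : BD S k Q) :
    BD S k fun v => P v → Q v :=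
  (hP.and hQ.not).not.congr fun v => by tauto

theorem BD.iff {k : ℕ} {P Q : (Fin k → N) → Prop} (hP : BD S k P) (hQ : BD S k Q) :
    BD S k fun v => P v ↔ Q v :=
  ((hP.imp hQ).and (hQ.imp hP)).congr fun v => by tauto

theorem BD.bex {k : ℕ} {f : (Fin k → N) → N} {Q : (Fin k → N) → N → Prop} (hf : TF k f)
    (hQ : BD S (k + 1) fun w => Q (Fin.tail w) (w 0)) :
    BD S k fun v => ∃ n, n < f v ∧ Q v n :=
  BD.bex_cons hf hQ

theorem BD.ball {k : ℕ} {f : (Fin k → N) → N} {Q : (Fin k → N) → N → Prop} (hf : TF k f)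
    (hQ : BD S (k + 1) fun w => Q (Fin.tail w) (w 0)) :
    BD S k fun v => ∀ n, n < f v → Q v n :=
  (BD.bex (Q := fun v n => ¬ Q v n) hf hQ.not).not.congr fun v => by push Not; rfl

theorem BD.const {k : ℕ} (p : Prop) : BD S k fun _ => p := by
  by_cases hp : p
  · exact (BD.eq (.const 0) (.const 0)).congr fun _ => by simp [hp]
  · exact (BD.eq (.const 0) (.const 0)).not.congr fun _ => by simp [hp]

theorem BD.comp {k : ℕ} {P : (Fin k → N) → Prop} (hP : BD S k P) : ∀ {l : ℕ}
    {g : Fin k → (Fin l → N) → N}, (∀ i, TF l (g i)) → BD S l fun v => P fun i => g i v := by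
  induction hP with
  | eq hf hf' => exact fun hg => .eq (hf.comp hg) (hf'.comp hg)
  | lt hf hf' => exact fun hg => .lt (hf.comp hg) (hf'.comp hg)
  | mem hX hf => exact fun hg => .mem hX (hf.comp hg)
  | not _ ih => exact fun hg => (ih hg).not
  | and _ _ ih₁ ih₂ => exact fun hg => (ih₁ hg).and (ih₂ hg)
  | @bex_cons k f Q hf _ ih =>
    intro l g hg
    refine BD.bex (hf.comp hg) (Q := fun v n => Q (Fin.cons n fun i => g i v)) ?_
    refine (ih (g := Fin.cons (fun w => w 0) fun i w => g i (Fin.tail w)) ?_).congr fun w => ?_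
    · exact Fin.cases (.proj 0) fun i => (hg i).weaken
    · have : (Fin.cons (w 0) fun i => g i (Fin.tail w) : Fin (k + 1) → N) =
          fun i => (Fin.cons (fun w => w 0) fun i w => g i (Fin.tail w) :
            Fin (k + 1) → (Fin (l + 1) → N) → N) i w :=
        funext (Fin.cases rfl fun _ => rfl)
      rw [this]

theorem Term.eval_congr {t : Term} {v w : ℕ → N} (h : ∀ x, t.Occurs x → v x = w x) :
    t.eval v = t.eval w := by
  induction t with
  | var x => exact h x rfl
  | zero => rfl
  | one => rfl
  | add s t hs ht =>
    exact congrArg₂ (· + ·) (hs fun x hx => h x (Or.inl hx)) (ht fun x hx => h x (Or.inr hx))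
  | mul s t hs ht =>
    exact congrArg₂ (· * ·) (hs fun x hx => h x (Or.inl hx)) (ht fun x hx => h x (Or.inr hx))

/-- Even variables carry the arguments and odd ones the parameters. Only the countable set `F` of
parameters is fixed by `f`; the enumeration `p` stays arbitrary so that several terms can share one
assignment. -/
theorem TF.exists_term {k : ℕ} {f : (Fin k → N) → N} (hf : TF k f) :
    ∃ F : Set N, F.Countable ∧ ∀ p : ℕ → N, F ⊆ Set.range p → ∀ ρ : Fin k → ℕ, ∃ t : Term,
      (∀ x, t.Occurs x → (∃ i, x = 2 * ρ i) ∨ ∃ j, x = 2 * j + 1) ∧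
      ∀ w : ℕ → N, (∀ j, w (2 * j + 1) = p j) → t.eval w = f fun i => w (2 * ρ i) := by
  induction hf with
  | const c =>
    refine ⟨{c}, Set.countable_singleton c, fun p hp ρ => ?_⟩
    obtain ⟨j, rfl⟩ := hp rfl
    exact ⟨.var (2 * j + 1), fun x hx => Or.inr ⟨j, hx⟩, fun w hw => hw j⟩
  | proj i =>
    exact ⟨∅, Set.countable_empty, fun p _ ρ =>
      ⟨.var (2 * ρ i), fun x hx => Or.inl ⟨i, hx⟩, fun w _ => rfl⟩⟩
  | add _ _ h₁ h₂ =>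
    obtain ⟨F, hF, h₁⟩ := h₁
    obtain ⟨G, hG, h₂⟩ := h₂
    refine ⟨F ∪ G, hF.union hG, fun p hp ρ => ?_⟩
    obtain ⟨s, hs, hs'⟩ := h₁ p (Set.subset_union_left.trans hp) ρ
    obtain ⟨t, ht, ht'⟩ := h₂ p (Set.subset_union_right.trans hp) ρ
    exact ⟨.add s t, fun x hx => hx.elim (hs x) (ht x),
      fun w hw => congrArg₂ _ (hs' w hw) (ht' w hw)⟩
  | mul _ _ h₁ h₂ =>
    obtain ⟨F, hF, h₁⟩ := h₁
    obtain ⟨G, hG, h₂⟩ := h₂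
    refine ⟨F ∪ G, hF.union hG, fun p hp ρ => ?_⟩
    obtain ⟨s, hs, hs'⟩ := h₁ p (Set.subset_union_left.trans hp) ρ
    obtain ⟨t, ht, ht'⟩ := h₂ p (Set.subset_union_right.trans hp) ρ
    exact ⟨.mul s t, fun x hx => hx.elim (hs x) (ht x),
      fun w hw => congrArg₂ _ (hs' w hw) (ht' w hw)⟩

/-- The placement `ρ` of the arguments is universally quantified so that the induction can extend it
by a new variable under a bounded quantifier. -/
theorem BD.exists_formula {k : ℕ} {P : (Fin k → N) → Prop} (hP : BD S k P) :
    ∃ F : Set N, F.Countable ∧ ∃ G ⊆ S, G.Countable ∧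
      ∀ p : ℕ → N, F ⊆ Set.range p → ∀ V : ℕ → Set N, G ⊆ Set.range V → ∀ ρ : Fin k → ℕ,
      ∃ φ : ArithFormula, IsBounded φ ∧
      ∀ w : ℕ → N, (∀ j, w (2 * j + 1) = p j) → (φ.Sat V w ↔ P fun i => w (2 * ρ i)) := by
  induction hP with
  | eq hf hg =>
    obtain ⟨F, hF, h₁⟩ := hf.exists_term
    obtain ⟨G, hG, h₂⟩ := hg.exists_term
    refine ⟨F ∪ G, hF.union hG, ∅, Set.empty_subset _, Set.countable_empty, fun p hp V _ ρ => ?_⟩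
    obtain ⟨s, -, hs⟩ := h₁ p (Set.subset_union_left.trans hp) ρ
    obtain ⟨t, -, ht⟩ := h₂ p (Set.subset_union_right.trans hp) ρ
    refine ⟨.eq s t, .eq s t, fun w hw => ?_⟩
    rw [ArithFormula.Sat, hs w hw, ht w hw]
  | lt hf hg =>
    obtain ⟨F, hF, h₁⟩ := hf.exists_term
    obtain ⟨G, hG, h₂⟩ := hg.exists_term
    refine ⟨F ∪ G, hF.union hG, ∅, Set.empty_subset _, Set.countable_empty, fun p hp V _ ρ => ?_⟩
    obtain ⟨s, -, hs⟩ := h₁ p (Set.subset_union_left.trans hp) ρ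
    obtain ⟨t, -, ht⟩ := h₂ p (Set.subset_union_right.trans hp) ρ
    refine ⟨.lt s t, .lt s t, fun w hw => ?_⟩
    rw [ArithFormula.Sat, hs w hw, ht w hw]
  | @mem k f X hX hf =>
    obtain ⟨F, hF, h₁⟩ := hf.exists_term
    refine ⟨F, hF, {X}, Set.singleton_subset_iff.2 hX, Set.countable_singleton X,
      fun p hp V hV ρ => ?_⟩
    obtain ⟨i, rfl⟩ := hV rfl
    obtain ⟨s, -, hs⟩ := h₁ p hp ρ
    refine ⟨.mem s i, .mem s i, fun w hw => ?_⟩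
    rw [ArithFormula.Sat, hs w hw]
  | not _ ih =>
    obtain ⟨F, hF, G, hGS, hG, h⟩ := ih
    refine ⟨F, hF, G, hGS, hG, fun p hp V hV ρ => ?_⟩
    obtain ⟨φ, hφ, hφ'⟩ := h p hp V hV ρ
    exact ⟨.neg φ, hφ.neg, fun w hw => not_congr (hφ' w hw)⟩
  | and _ _ ih₁ ih₂ =>
    obtain ⟨F, hF, G, hGS, hG, h⟩ := ih₁
    obtain ⟨F', hF', G', hGS', hG', h'⟩ := ih₂
    refine ⟨F ∪ F', hF.union hF', G ∪ G', Set.union_subset hGS hGS', hG.union hG',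
      fun p hp V hV ρ => ?_⟩
    obtain ⟨φ, hφ, hφ'⟩ :=
      h p (Set.subset_union_left.trans hp) V (Set.subset_union_left.trans hV) ρ
    obtain ⟨ψ, hψ, hψ'⟩ :=
      h' p (Set.subset_union_right.trans hp) V (Set.subset_union_right.trans hV) ρ
    exact ⟨.and φ ψ, hφ.and hψ, fun w hw => and_congr (hφ' w hw) (hψ' w hw)⟩
  | @bex_cons k f Q hf _ ih =>
    obtain ⟨F, hF, h₁⟩ := hf.exists_term
    obtain ⟨F', hF', G, hGS, hG, h₂⟩ := ih
    refine ⟨F ∪ F', hF.union hF', G, hGS, hG, fun p hp V hV ρ => ?_⟩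
    obtain ⟨t, htx, ht⟩ := h₁ p (Set.subset_union_left.trans hp) ρ
    -- A fresh even variable: it clashes with no argument and, by parity, with no parameter, so it
    -- does not occur in the bound `t`.
    obtain ⟨y, hy⟩ : ∃ y, ∀ i, ρ i ≠ y := by
      obtain ⟨y, hy⟩ := Infinite.exists_notMem_finset (Finset.univ.image ρ)
      exact ⟨y, fun i hi => hy (by simp [← hi])⟩
    obtain ⟨φ, hφ, hφ'⟩ := h₂ p (Set.subset_union_right.trans hp) V hV (Fin.cons y ρ)
    have hyt : ¬ t.Occurs (2 * y) := fun h => by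
      rcases htx _ h with ⟨i, hi⟩ | ⟨j, hj⟩
      · exact hy i (by omega)
      · omega
    refine ⟨_, .bex (2 * y) t hyt hφ, fun w hw => ?_⟩
    refine exists_congr fun n => and_congr ?_ ?_
    · have : t.eval (Function.update w (2 * y) n) = t.eval w :=
        Term.eval_congr fun x hx => Function.update_of_ne (by rintro rfl; exact hyt hx) _ _
      rw [ArithFormula.Sat, this, ht w hw]
      simp [Term.eval]
    · rw [hφ' _ fun j => by rw [Function.update_of_ne (by omega), hw j]]
      have : (fun i => Function.update w (2 * y) n (2 * (Fin.cons y ρ : Fin (k + 1) → ℕ) i)) =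
          Fin.cons n fun i => w (2 * ρ i) := by
        refine funext (Fin.cases (by simp) fun i => ?_)
        have := hy i
        simp [Function.update_of_ne (show 2 * ρ i ≠ 2 * y by omega)]
      rw [this]

/-- Δ⁰₁ comprehension evaluates both its formulas under the same assignments, so the parameters of
`P` and `Q` are enumerated together. -/
theorem BD.exists_formulas (hS : S.Nonempty) {P Q : (Fin 2 → N) → Prop} (hP : BD S 2 P)
    (hQ : BD S 2 Q) : ∃ V : ℕ → Set N, (∀ i, V i ∈ S) ∧ ∃ w : ℕ → N, ∃ φ ψ : ArithFormula,
      IsBounded φ ∧ IsBounded ψ ∧ ∀ a b : N,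
        (φ.Sat V (Function.update (Function.update w 0 a) 2 b) ↔ P ![b, a]) ∧
        (ψ.Sat V (Function.update (Function.update w 0 a) 2 b) ↔ Q ![b, a]) := by
  obtain ⟨F, hF, G, hGS, hG, h⟩ := hP.exists_formula
  obtain ⟨F', hF', G', hGS', hG', h'⟩ := hQ.exists_formula
  obtain ⟨X, hX⟩ := hS
  -- Inserting `0`, and below `X`, makes the countable sets nonempty, hence ranges of sequences.
  obtain ⟨p, hp⟩ := (((hF.union hF').insert 0).exists_eq_range (Set.insert_nonempty _ _))
  obtain ⟨V, hV⟩ := (((hG.union hG').insert X).exists_eq_range (Set.insert_nonempty _ _))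
  have hp' : F ∪ F' ⊆ Set.range p := hp ▸ Set.subset_insert _ _
  have hV' : G ∪ G' ⊆ Set.range V := hV ▸ Set.subset_insert _ _
  obtain ⟨φ, hφ, hφ'⟩ :=
    h p (Set.subset_union_left.trans hp') V (Set.subset_union_left.trans hV') ![1, 0]
  obtain ⟨ψ, hψ, hψ'⟩ :=
    h' p (Set.subset_union_right.trans hp') V (Set.subset_union_right.trans hV') ![1, 0]
  have hVS : ∀ i, V i ∈ S := fun i =>
    Set.insert_subset hX (Set.union_subset hGS hGS') (hV ▸ Set.mem_range_self i)
  refine ⟨V, hVS, fun i => p (i / 2), φ, ψ, hφ, hψ, fun a b => ?_⟩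
  have hw : ∀ j, Function.update (Function.update (fun i => p (i / 2)) 0 a) 2 b (2 * j + 1) =
      p j := fun j => by
    rw [Function.update_of_ne (by omega), Function.update_of_ne (by omega)]
    congr 1
    omega
  have he : (fun i => Function.update (Function.update (fun i => p (i / 2)) 0 a) 2 b
      (2 * (![1, 0] : Fin 2 → ℕ) i)) = ![b, a] := by
    funext i
    fin_cases i <;> simp
  exact ⟨by rw [hφ' _ hw, he], by rw [hψ' _ hw, he]⟩

theorem RCA0.sigma_induction (h : RCA0 S) (hS : S.Nonempty) {R : N → N → Prop}
    (hR : BD S 2 fun v => R (v 1) (v 0)) (h0 : ∃ m, R 0 m)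
    (h1 : ∀ n, (∃ m, R n m) → ∃ m, R (n + 1) m) (n : N) : ∃ m, R n m := by
  obtain ⟨V, hV, w, φ, ψ, hφ, -, H⟩ := BD.exists_formulas hS hR hR
  have key : ∀ n, (ArithFormula.ex 2 φ).Sat V (Function.update w 0 n) ↔ ∃ m, R n m :=
    fun n => exists_congr fun m => (H n m).1
  have := h.sigma1_induction (.ex 2 φ) ⟨2, φ, hφ, rfl⟩ 0 w V hV
  simp only [key] at this
  exact this h0 h1 n

theorem RCA0.induction (h : RCA0 S) (hS : S.Nonempty) {P : N → Prop}
    (hP : BD S 1 fun v => P (v 0)) (h0 : P 0) (h1 : ∀ n, P n → P (n + 1)) (n : N) : P n := by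
  simpa using h.sigma_induction hS (R := fun n _ => P n)
    (hP.comp (g := fun _ v => v 1) fun _ => .proj 1) ⟨0, h0⟩
    (fun n ⟨_, hn⟩ => ⟨0, h1 n hn⟩) n

theorem RCA0.delta_comprehension (h : RCA0 S) (hS : S.Nonempty) {R R' : N → N → Prop}
    (hR : BD S 2 fun v => R (v 1) (v 0)) (hR' : BD S 2 fun v => R' (v 1) (v 0))
    (hRR' : ∀ n, (∃ m, R n m) ↔ ∀ m, R' n m) : {n | ∃ m, R n m} ∈ S := by
  obtain ⟨V, hV, w, φ, ψ, hφ, hψ, H⟩ := BD.exists_formulas hS hR hR'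
  have key : ∀ n, (ArithFormula.ex 2 φ).Sat V (Function.update w 0 n) ↔ ∃ m, R n m :=
    fun n => exists_congr fun m => (H n m).1
  have key' : ∀ n, (ArithFormula.all 2 ψ).Sat V (Function.update w 0 n) ↔ ∀ m, R' n m :=
    fun n => forall_congr' fun m => (H n m).2
  obtain ⟨X, hX, hX'⟩ := h.delta1_comprehension (.ex 2 φ) (.all 2 ψ) ⟨2, φ, hφ, rfl⟩
    ⟨2, ψ, hψ, rfl⟩ 0 w V hV fun n => by rw [key, key', hRR']
  rwa [show {n | ∃ m, R n m} = X from Set.ext fun n => by rw [hX', key]; rfl]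

theorem RCA0.comprehension (h : RCA0 S) (hS : S.Nonempty) {P : N → Prop}
    (hP : BD S 1 fun v => P (v 0)) : {n | P n} ∈ S := by
  have := hP.comp (l := 2) (g := fun _ v => v 1) fun _ => .proj 1
  simpa using h.delta_comprehension hS (R := fun n _ => P n) (R' := fun n _ => P n) this this
    fun n => ⟨fun ⟨_, h⟩ _ => h, fun h => ⟨0, h 0⟩⟩

end Definability

/-! ### Semiring laws -/

section Arithmetic

variable {N : Type u} [Zero N] [One N] [Add N] [Mul N] [LT N] {S : Set (Set N)}

/-- The arithmetic of a model of `RCA₀` is a commutative semiring. -/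
@[reducible] def RCA0.commSemiring (h : RCA0 S) (hS : S.Nonempty) : CommSemiring N :=
  have B := h.basic
  have ind : ∀ {P : N → Prop}, (BD S 1 fun v => P (v 0)) → P 0 → (∀ n, P n → P (n + 1)) →
    ∀ n, P n := fun hP => h.induction hS hP
  have p : TF 1 fun v : Fin 1 → N => v 0 := .proj 0
  -- The axioms recur on the right argument, so each induction below runs on the rightmost variable.
  have add_assoc : ∀ a b c : N, a + b + c = a + (b + c) := fun a b => by
    refine ind (.eq (.add (.const _) p) (.add (.const _) (.add (.const _) p))) ?_ fun n hn => ?_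
    · rw [B.add_zero, B.add_zero]
    · rw [B.add_succ, B.add_succ, B.add_succ, hn]
  have zero_add : ∀ a : N, 0 + a = a := by
    refine ind (.eq (.add (.const _) p) p) (B.add_zero 0) fun n hn => ?_
    rw [B.add_succ, hn]
  have one_add : ∀ a : N, 1 + a = a + 1 := by
    refine ind (.eq (.add (.const _) p) (.add p (.const _))) ?_ fun n hn => ?_
    · rw [B.add_zero, zero_add]
    · rw [B.add_succ, hn]
  have add_comm : ∀ a b : N, a + b = b + a := fun a => by
    refine ind (.eq (.add (.const _) p) (.add p (.const _))) ?_ fun n hn => ?_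
    · rw [B.add_zero, zero_add]
    · rw [B.add_succ, hn, add_assoc, add_assoc, one_add]
  have zero_mul : ∀ a : N, 0 * a = 0 := by
    refine ind (.eq (.mul (.const _) p) (.const _)) (B.mul_zero 0) fun n hn => ?_
    rw [B.mul_succ, hn, B.add_zero]
  have mul_one : ∀ a : N, a * 1 = a := fun a => by
    rw [← zero_add (1 : N), B.mul_succ, B.mul_zero, zero_add]
  have left_distrib : ∀ a b c : N, a * (b + c) = a * b + a * c := fun a b => by
    refine ind (.eq (.mul (.const _) (.add (.const _) p))
      (.add (.const _) (.mul (.const _) p))) ?_ fun n hn => ?_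
    · rw [B.mul_zero, B.add_zero, B.add_zero]
    · rw [B.add_succ, B.mul_succ, B.mul_succ, hn, add_assoc]
  have right_distrib : ∀ a b c : N, (a + b) * c = a * c + b * c := fun a b => by
    refine ind (.eq (.mul (.const _) p) (.add (.mul (.const _) p) (.mul (.const _) p)))
      ?_ fun n hn => ?_
    · rw [B.mul_zero, B.mul_zero, B.mul_zero, B.add_zero]
    · rw [B.mul_succ, B.mul_succ, B.mul_succ, hn, add_assoc, add_assoc, ← add_assoc (b * n),
        add_comm (b * n), add_assoc]
  have one_mul : ∀ a : N, 1 * a = a := by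
    refine ind (.eq (.mul (.const _) p) p) (B.mul_zero 1) fun n hn => ?_
    rw [B.mul_succ, hn]
  have mul_comm : ∀ a b : N, a * b = b * a := fun a => by
    refine ind (.eq (.mul (.const _) p) (.mul p (.const _))) ?_ fun n hn => ?_
    · rw [B.mul_zero, zero_mul]
    · rw [B.mul_succ, hn, right_distrib, one_mul]
  have mul_assoc : ∀ a b c : N, a * b * c = a * (b * c) := fun a b => by
    refine ind (.eq (.mul (.const _) p) (.mul (.const _) (.mul (.const _) p))) ?_ fun n hn => ?_
    · rw [B.mul_zero, B.mul_zero, B.mul_zero]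
    · rw [B.mul_succ, B.mul_succ, hn, left_distrib]
  { add_assoc, zero_add, add_zero := B.add_zero, add_comm, left_distrib, right_distrib, zero_mul,
    mul_zero := B.mul_zero, mul_assoc, one_mul, mul_one, mul_comm, nsmul := nsmulRec }

end Arithmetic

/-! ### The linear order -/

section Order

variable {N : Type u} [CommSemiring N] [LT N] {S : Set (Set N)}

theorem RCA0.eq_zero_or_succ (h : RCA0 S) (hS : S.Nonempty) (n : N) :
    n = 0 ∨ ∃ m, n = m + 1 := by
  obtain ⟨m, hm⟩ := h.sigma_induction hS (R := fun n m => n = 0 ∨ n = m + 1)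
    (.or (.eq (.proj 1) (.const _)) (.eq (.proj 1) (.add (.proj 0) (.const _))))
    ⟨0, Or.inl rfl⟩ (fun n _ => ⟨n, Or.inr rfl⟩) n
  exact hm.imp_right fun hm => ⟨m, hm⟩

theorem RCA0.lt_iff_exists_add (h : RCA0 S) (hS : S.Nonempty) (a b : N) :
    a < b ↔ ∃ c, b = a + (c + 1) := by
  constructor
  · intro hab
    -- The implication sits inside the existential quantifier so that the induction statement is
    -- Σ⁰₁.
    have step : ∀ n, (∃ c, a < n → n = a + (c + 1)) → ∃ c, a < n + 1 → n + 1 = a + (c + 1) := by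
      rintro n ⟨c, hc⟩
      by_cases han : a < n
      · exact ⟨c + 1, fun _ => by rw [← add_assoc a, ← hc han]⟩
      · refine ⟨0, fun han' => ?_⟩
        rcases (h.basic.lt_succ _ _).1 han' with h' | rfl
        · exact (han h').elim
        · rw [zero_add]
    obtain ⟨c, hc⟩ := h.sigma_induction hS (R := fun b c => a < b → b = a + (c + 1))
      (.imp (.lt (.const _) (.proj 1))
        (.eq (.proj 1) (.add (.const _) (.add (.proj 0) (.const _)))))
      ⟨0, fun h0 => (h.basic.not_lt_zero a h0).elim⟩ step b
    exact ⟨c, hc hab⟩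
  · rintro ⟨c, rfl⟩
    revert c
    refine h.induction hS (.lt (.const _) (.add (.const _) (.add (.proj 0) (.const _)))) ?_ ?_
    · rw [zero_add]; exact (h.basic.lt_succ _ _).2 (Or.inr rfl)
    · intro n hn
      rw [← add_assoc]
      exact (h.basic.lt_succ _ _).2 (Or.inl hn)

theorem RCA0.add_left_cancel (h : RCA0 S) (hS : S.Nonempty) (a b c : N) :
    a + b = a + c → b = c := by
  rw [add_comm a, add_comm a]
  revert a
  refine h.induction hS (.imp (.eq (.add (.const _) (.proj 0)) (.add (.const _) (.proj 0)))
    (.eq (.const _) (.const _))) ?_ ?_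
  · simp
  · intro n hn hbc
    rw [← add_assoc, ← add_assoc] at hbc
    exact hn (h.basic.succ_inj _ _ hbc)

theorem RCA0.lt_trichotomy (h : RCA0 S) (hS : S.Nonempty) (a b : N) : a < b ∨ a = b ∨ b < a := by
  revert a
  refine h.induction hS (.or (.lt (.proj 0) (.const _)) (.or (.eq (.proj 0) (.const _))
    (.lt (.const _) (.proj 0)))) ?_ ?_
  · rcases h.eq_zero_or_succ hS b with rfl | ⟨m, rfl⟩
    · exact Or.inr (Or.inl rfl)
    · exact Or.inl ((h.lt_iff_exists_add hS _ _).2 ⟨m, by rw [zero_add]⟩)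
  · rintro n (hn | rfl | hn)
    · obtain ⟨c, rfl⟩ := (h.lt_iff_exists_add hS _ _).1 hn
      rcases h.eq_zero_or_succ hS c with rfl | ⟨m, rfl⟩
      · right; left; ring
      · exact Or.inl ((h.lt_iff_exists_add hS _ _).2 ⟨m, by ring⟩)
    · exact Or.inr (Or.inr ((h.basic.lt_succ _ _).2 (Or.inr rfl)))
    · exact Or.inr (Or.inr ((h.basic.lt_succ _ _).2 (Or.inl hn)))

theorem RCA0.lt_irrefl (h : RCA0 S) (hS : S.Nonempty) (a : N) : ¬ a < a := fun ha => by
  obtain ⟨c, hc⟩ := (h.lt_iff_exists_add hS _ _).1 ha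
  rw [← add_zero a, add_assoc] at hc
  have := h.add_left_cancel hS _ _ _ hc
  rw [zero_add] at this
  exact h.basic.succ_ne_zero _ this.symm

theorem RCA0.lt_trans (h : RCA0 S) (hS : S.Nonempty) {a b c : N} (hab : a < b) (hbc : b < c) :
    a < c := by
  obtain ⟨d, rfl⟩ := (h.lt_iff_exists_add hS _ _).1 hab
  obtain ⟨e, rfl⟩ := (h.lt_iff_exists_add hS _ _).1 hbc
  exact (h.lt_iff_exists_add hS _ _).2 ⟨d + e + 1, by ring⟩

open Classical in
/-- The numbers of a model of `RCA₀` are linearly ordered. -/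
@[reducible] noncomputable def RCA0.linearOrder (h : RCA0 S) (hS : S.Nonempty) : LinearOrder N :=
  { lt := (· < ·)
    le := fun a b => a < b ∨ a = b
    le_refl := fun _ => Or.inr rfl
    le_trans := by
      rintro a b c (hab | rfl) (hbc | rfl)
      · exact Or.inl (h.lt_trans hS hab hbc)
      · exact Or.inl hab
      · exact Or.inl hbc
      · exact Or.inr rfl
    lt_iff_le_not_ge := fun a b => by
      refine ⟨fun hab => ⟨Or.inl hab, ?_⟩, ?_⟩
      · rintro (hba | rfl)
        · exact h.lt_irrefl hS a (h.lt_trans hS hab hba)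
        · exact h.lt_irrefl hS _ hab
      · rintro ⟨hab | rfl, hba⟩
        · exact hab
        · exact (hba (Or.inr rfl)).elim
    le_antisymm := by
      rintro a b (hab | rfl) hba
      · rcases hba with hba | rfl
        · exact (h.lt_irrefl hS a (h.lt_trans hS hab hba)).elim
        · rfl
      · rfl
    le_total := fun a b => by
      rcases h.lt_trichotomy hS a b with hab | rfl | hab
      · exact Or.inl (Or.inl hab)
      · exact Or.inl (Or.inr rfl)
      · exact Or.inr (Or.inl hab)
    toDecidableLE := Classical.decRel _ }

end Order

/-! ### Compatibility of the order with the operations -/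

section OrderedSemiring

variable {N : Type u} [CommSemiring N] [LinearOrder N] {S : Set (Set N)}

theorem RCA0.isStrictOrderedRing (h : RCA0 S) (hS : S.Nonempty) : IsStrictOrderedRing N := by
  have hlt := h.lt_iff_exists_add hS
  have add_lt : ∀ a b c : N, b < c → a + b < a + c := fun a b c hbc => by
    obtain ⟨d, rfl⟩ := (hlt _ _).1 hbc
    exact (hlt _ _).2 ⟨d, by ring⟩
  have mul_lt : ∀ a : N, 0 < a → ∀ b c : N, b < c → a * b < a * c := fun a ha b c hbc => by
    obtain ⟨d, rfl⟩ := (hlt _ _).1 hbc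
    obtain ⟨e, rfl⟩ := (hlt _ _).1 ha
    -- The difference is `(e + 1) * (d + 1) = (e * d + e + d) + 1`.
    exact (hlt _ _).2 ⟨e * d + e + d, by ring⟩
  have add_le : ∀ b c : N, b ≤ c → ∀ a, a + b ≤ a + c := fun b c hbc a => by
    rcases hbc.lt_or_eq with hbc | rfl
    · exact (add_lt a b c hbc).le
    · exact le_rfl
  exact
  { add_le_add_left := fun b c hbc a => by
      rw [add_comm b, add_comm c]; exact add_le b c hbc a
    le_of_add_le_add_left := fun a b c habc => by
      by_contra! hcb
      exact (add_lt a c b hcb).not_ge habc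
    zero_le_one := ((hlt 0 1).2 ⟨0, by simp⟩).le
    exists_pair_ne := ⟨0, 1, ((hlt 0 1).2 ⟨0, by simp⟩).ne⟩
    mul_lt_mul_of_pos_left := fun a ha b c hbc => mul_lt a ha b c hbc
    mul_lt_mul_of_pos_right := fun a ha b c hbc => by
      rw [mul_comm b, mul_comm c]
      exact mul_lt a ha b c hbc }

theorem RCA0.canonicallyOrderedAdd (h : RCA0 S) (hS : S.Nonempty) : CanonicallyOrderedAdd N := by
  have hlt := h.lt_iff_exists_add hS
  have le_add : ∀ a b : N, a ≤ a + b := fun a b => by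
    rcases h.eq_zero_or_succ hS b with rfl | ⟨m, rfl⟩
    · rw [add_zero]
    · exact ((hlt _ _).2 ⟨m, rfl⟩).le
  exact
  { exists_add_of_le := fun {a b} hab => by
      rcases hab.lt_or_eq with hab | rfl
      · obtain ⟨c, hc⟩ := (hlt _ _).1 hab
        exact ⟨_, hc⟩
      · exact ⟨0, (add_zero a).symm⟩
    le_self_add := le_add
    le_add_self := fun a b => by rw [add_comm]; exact le_add a b }

end OrderedSemiring

/-! ### Pairs and codes of finite sets -/

section FiniteSets

variable {N : Type u} [CommSemiring N] [LinearOrder N] [IsStrictOrderedRing N]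
  [CanonicallyOrderedAdd N] {S : Set (Set N)}

theorem RCA0.lt_add_one_iff (h : RCA0 S) {a b : N} : a < b + 1 ↔ a ≤ b := by
  rw [h.basic.lt_succ, le_iff_lt_or_eq]

theorem RCA0.add_one_le (h : RCA0 S) {a b : N} (hab : a < b) : a + 1 ≤ b := by
  by_contra! hba
  exact (h.lt_add_one_iff.1 hba).not_gt hab

theorem RCA0.le_mul_self (h : RCA0 S) (a : N) : a ≤ a * a := by
  rcases eq_or_ne a 0 with rfl | ha
  · simp
  · exact le_mul_of_one_le_right' (by simpa using h.add_one_le (pos_iff_ne_zero.2 ha))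

theorem left_le_pair (i j : N) : i ≤ pair i j := le_add_self

theorem RCA0.right_le_pair (h : RCA0 S) (i j : N) : j ≤ pair i j :=
  (le_add_self.trans (h.le_mul_self (i + j))).trans le_self_add

/-- With `s = i + j`, the pair lies between `s²` and `s² + s < (s + 1)²`, so it determines `s`. -/
theorem RCA0.pair_lt_pair (h : RCA0 S) {i j i' j' : N} (hs : i + j < i' + j') :
    pair i j < pair i' j' :=
  calc (i + j) * (i + j) + i ≤ (i + j) * (i + j) + (i + j) := by gcongr; exact le_self_add
    _ ≤ (i + j) * (i + j) + (i + j) + (i + j) := le_self_add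
    _ < (i + j) * (i + j) + (i + j) + (i + j) + 1 := lt_add_one _
    _ = (i + j + 1) * (i + j + 1) := by ring
    _ ≤ (i' + j') * (i' + j') := mul_le_mul' (h.add_one_le hs) (h.add_one_le hs)
    _ ≤ _ := le_self_add

theorem RCA0.pair_inj (h : RCA0 S) {i j i' j' : N} :
    pair i j = pair i' j' ↔ i = i' ∧ j = j' := by
  refine ⟨fun hp => ?_, fun hp => by rw [hp.1, hp.2]⟩
  have hs : i + j = i' + j' := by
    rcases _root_.lt_trichotomy (i + j) (i' + j') with hs | hs | hs
    · exact ((h.pair_lt_pair hs).ne hp).elim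
    · exact hs
    · exact ((h.pair_lt_pair hs).ne' hp).elim
  have hi : i = i' := by
    rw [pair, pair, hs] at hp
    exact _root_.add_left_cancel hp
  subst hi
  exact ⟨rfl, _root_.add_left_cancel hs⟩

theorem RCA0.lt_of_mem_decode (_ : RCA0 S) {i c : N} (hi : i ∈ decode c) : i < c := by
  obtain ⟨k, m, n, rfl, hik, -⟩ := hi
  exact hik.trans_le (left_le_pair _ _)

theorem RCA0.mem_decode_pair (h : RCA0 S) {i k m n : N} :
    i ∈ decode (pair k (pair m n)) ↔ i < k ∧ ∃ q, n = (m * (i + 1) + 1) * q := by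
  constructor
  · rintro ⟨k', m', n', hp, hi⟩
    obtain ⟨rfl, hp'⟩ := h.pair_inj.1 hp
    obtain ⟨rfl, rfl⟩ := h.pair_inj.1 hp'
    exact hi
  · exact fun hi => ⟨k, m, n, rfl, hi⟩

/-- Elements lie below their code, so extensional equality becomes a bounded condition. -/
theorem RCA0.decode_ext_of_le (h : RCA0 S) {b c d : N} (hc : c ≤ b) (hd : d ≤ b) :
    decode c = decode d ↔ ∀ i, i < b → (i ∈ decode c ↔ i ∈ decode d) := by
  refine ⟨fun hcd i _ => by rw [hcd], fun hcd => Set.ext fun i => ⟨fun hi => ?_, fun hi => ?_⟩⟩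
  · exact (hcd i ((h.lt_of_mem_decode hi).trans_le hc)).1 hi
  · exact (hcd i ((h.lt_of_mem_decode hi).trans_le hd)).2 hi

theorem TF.pair {k : ℕ} {f g : (Fin k → N) → N} (hf : TF k f) (hg : TF k g) :
    TF k fun v => pair (f v) (g v) :=
  ((hf.add hg).mul (hf.add hg)).add hf

theorem TF.succ {k : ℕ} {f : (Fin k → N) → N} (hf : TF k f) : TF k fun v => f v + 1 :=
  hf.add (.const 1)

theorem RCA0.bd_isTriple (h : RCA0 S) {k : ℕ} {f : (Fin k → N) → N} (hf : TF k f) :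
    BD S k fun v => IsTriple (f v) := by
  have : ∀ c : N, IsTriple c ↔ ∃ k, k < c + 1 ∧ ∃ m, m < c + 1 ∧ ∃ n, n < c + 1 ∧
      c = SOA.pair k (SOA.pair m n) := by
    refine fun c => ⟨?_, fun ⟨k, _, m, _, n, _, hc⟩ => ⟨k, m, n, hc⟩⟩
    rintro ⟨k, m, n, rfl⟩
    have hmn := h.right_le_pair k (SOA.pair m n)
    exact ⟨k, h.lt_add_one_iff.2 (left_le_pair _ _),
      m, h.lt_add_one_iff.2 ((left_le_pair _ _).trans hmn),
      n, h.lt_add_one_iff.2 ((h.right_le_pair _ _).trans hmn), rfl⟩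
  refine BD.congr ?_ fun v => this (f v)
  exact .bex hf.succ (.bex hf.weaken.succ (.bex hf.weaken.weaken.succ
    (.eq hf.weaken.weaken.weaken (.pair (.proj 2) (.pair (.proj 1) (.proj 0))))))

/-- All witnesses are bounded by the code: the components of a pair do not exceed it, and the
quotient `q` does not exceed `n` because the divisor is at least `1`. -/
theorem RCA0.bd_mem_decode (h : RCA0 S) {k : ℕ} {f g : (Fin k → N) → N} (hf : TF k f)
    (hg : TF k g) : BD S k fun v => f v ∈ decode (g v) := by
  have : ∀ i c : N, i ∈ decode c ↔ ∃ k, k < c + 1 ∧ ∃ m, m < c + 1 ∧ ∃ n, n < c + 1 ∧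
      c = SOA.pair k (SOA.pair m n) ∧ i < k ∧ ∃ q, q < n + 1 ∧ n = (m * (i + 1) + 1) * q := by
    refine fun i c => ⟨?_, fun ⟨k, _, m, _, n, _, hc, hi, q, _, hq⟩ =>
      ⟨k, m, n, hc, hi, q, hq⟩⟩
    rintro ⟨k, m, n, rfl, hi, q, hq⟩
    have hmn := h.right_le_pair k (SOA.pair m n)
    refine ⟨k, h.lt_add_one_iff.2 (left_le_pair _ _),
      m, h.lt_add_one_iff.2 ((left_le_pair _ _).trans hmn),
      n, h.lt_add_one_iff.2 ((h.right_le_pair _ _).trans hmn), rfl, hi, q,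
      h.lt_add_one_iff.2 ?_, hq⟩
    rw [hq, add_mul, one_mul]
    exact le_add_self
  refine BD.congr ?_ fun v => this (f v) (g v)
  have hf₃ := hf.weaken.weaken.weaken
  exact .bex hg.succ (.bex hg.weaken.succ (.bex hg.weaken.weaken.succ
    (.and (.eq hg.weaken.weaken.weaken (.pair (.proj 2) (.pair (.proj 1) (.proj 0))))
      (.and (.lt hf₃ (.proj 2)) (.bex (TF.succ (.proj 0))
        (.eq (.proj 1) (.mul (TF.succ (.mul (.proj 2) hf₃.weaken.succ)) (.proj 0))))))))

theorem RCA0.bd_isFinCode (h : RCA0 S) {k : ℕ} {f : (Fin k → N) → N} (hf : TF k f) :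
    BD S k fun v => IsFinCode (f v) := by
  have : ∀ c : N, IsFinCode c ↔ IsTriple c ∧ ∀ c', c' < c → IsTriple c' →
      ¬ ∀ i, i < c → (i ∈ decode c' ↔ i ∈ decode c) := by
    refine fun c => and_congr_right fun _ => forall_congr' fun c' => ?_
    by_cases hc : c' < c
    · rw [h.decode_ext_of_le hc.le le_rfl]
      tauto
    · simp [hc]
  refine BD.congr ?_ fun v => this (f v)
  exact .and (h.bd_isTriple hf) (.ball hf (.imp (h.bd_isTriple (.proj 0)) (.not
    (.ball hf.weaken (.iff (h.bd_mem_decode (.proj 0) (.proj 1))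
      (h.bd_mem_decode (.proj 0) hf.weaken.weaken))))))

theorem RCA0.exists_least (h : RCA0 S) (hS : S.Nonempty) {P : N → Prop}
    (hP : BD S 1 fun v => P (v 0)) {n : N} (hn : P n) : ∃ n, P n ∧ ∀ m, m < n → ¬ P m := by
  by_contra! hmin
  have key : ∀ n m, m < n → ¬ P m := by
    refine h.induction hS (.ball (.proj 0) (.not ?_)) (fun m hm => (not_lt_zero hm).elim)
      fun n ih m hm => ?_
    · exact hP.comp (g := fun _ w => w 0) fun _ => .proj 0
    · rcases (h.basic.lt_succ _ _).1 hm with hm | rfl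
      · exact ih m hm
      · intro hPm
        obtain ⟨l, hl, hPl⟩ := hmin m hPm
        exact ih l hl hPl
  exact key (n + 1) n (lt_add_one n) hn

/-- Take the least triple decoding to the same set; the bound `d + c` exceeds all elements of both
sets and keeps the condition bounded. -/
theorem RCA0.exists_isFinCode (h : RCA0 S) (hS : S.Nonempty) {c : N} (hc : IsTriple c) :
    ∃ d, IsFinCode d ∧ decode d = decode c := by
  have key : ∀ d : N, (∀ i, i < d + c → (i ∈ decode d ↔ i ∈ decode c)) ↔ decode d = decode c :=
    fun d => (h.decode_ext_of_le le_self_add le_add_self).symm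
  obtain ⟨d, ⟨hd, hdc⟩, hmin⟩ := h.exists_least hS
    (P := fun d => IsTriple d ∧ ∀ i, i < d + c → (i ∈ decode d ↔ i ∈ decode c))
    (.and (h.bd_isTriple (.proj 0)) (.ball (.add (.proj 0) (.const c))
      (.iff (h.bd_mem_decode (.proj 0) (.proj 1)) (h.bd_mem_decode (.proj 0) (.const c)))))
    (n := c) ⟨hc, fun _ _ => Iff.rfl⟩
  rw [key] at hdc
  exact ⟨d, ⟨hd, fun d' hd' hdd' hlt => hmin d' hlt ⟨hd', (key d').2 (hdd'.trans hdc)⟩⟩, hdc⟩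

theorem RCA0.exists_singleton_code (h : RCA0 S) (hS : S.Nonempty) (x : N) :
    ∃ d, IsFinCode d ∧ decode d = {x} := by
  -- With `m = x` and `n = x(x + 1) + 1`, the case `i = x` has quotient `1`. For `i < x`, a quotient
  -- `q + 1` would give `q` divisible by `x`: `q = 0` forces `i = x`, while `q ≥ x` makes the
  -- product too large.
  obtain ⟨d, hd, hdx⟩ := h.exists_isFinCode hS
    (c := pair (x + 1) (pair x (x * (x + 1) + 1))) ⟨_, _, _, rfl⟩
  refine ⟨d, hd, hdx.trans (Set.ext fun i => ?_)⟩
  rw [h.mem_decode_pair, h.lt_add_one_iff]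
  refine ⟨?_, fun hi => ⟨le_of_eq hi, 1, by rw [hi, mul_one]⟩⟩
  rintro ⟨hi, q, hq⟩
  by_contra hne
  have hlt : i < x := lt_of_le_of_ne hi hne
  have hx : 0 < x := pos_of_gt hlt
  obtain ⟨q, rfl⟩ : ∃ r, q = r + 1 := by
    rcases h.eq_zero_or_succ hS q with rfl | hr
    · rw [mul_zero] at hq
      exact (h.basic.succ_ne_zero _ hq).elim
    · exact hr
  have hq' : x * (x + 1) = x * (i + 1) + q * (x * (i + 1)) + q :=
    add_right_cancel (b := 1) (hq.trans (by ring))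
  -- Here `q < x` would be the remainder of `x(x + 1)` modulo `x`, hence `0`; the three cases
  -- compare the quotients.
  have hqx : x ≤ q := by
    by_contra! hqx
    have hA : x * (x + 1) = x * ((i + 1) * (q + 1)) + q := hq'.trans (by ring)
    rcases lt_or_ge (x + 1) ((i + 1) * (q + 1)) with hlt' | hge
    · exact ((mul_lt_mul_of_pos_left hlt' hx).trans_le le_self_add).ne hA
    rcases hge.lt_or_eq with hlt' | heq
    · have := mul_le_mul_right (h.add_one_le hlt') x
      rw [mul_add, mul_one] at this
      exact ((add_lt_add_right hqx _).trans_le this).ne' hA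
    · rw [heq] at hA
      have hq0 : q = 0 := _root_.add_left_cancel (hA.symm.trans (_root_.add_zero _).symm)
      rw [hq0, zero_add, mul_one] at heq
      exact hlt.ne (_root_.add_right_cancel heq)
  have : x * (x + 1) < x * (i + 1) + q * (x * (i + 1)) + q :=
    calc x * (x + 1) = x + x * (x * 1) := by ring
      _ < x * (i + 1) + x * (x * (i + 1)) + x := by
        rw [add_assoc]
        refine add_lt_add_of_le_of_lt (le_mul_of_one_le_right' le_add_self) ?_
        refine lt_add_of_le_of_pos ?_ hx
        gcongr
        exact le_add_self
      _ ≤ _ := by gcongr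
  exact this.ne hq'

theorem IsFinCode.eq_of_decode_eq {c d : N} (hc : IsFinCode c) (hd : IsFinCode d)
    (hcd : decode c = decode d) : c = d := by
  rcases _root_.lt_trichotomy c d with hlt | heq | hlt
  · exact (hd.2 c hc.1 hcd hlt).elim
  · exact heq
  · exact (hc.2 d hd.1 hcd.symm hlt).elim

end FiniteSets

/-! ### From Σ⁰₁ comprehension to arithmetical comprehension -/

section Equivalence

variable {N : Type u} [CommSemiring N] [LinearOrder N] [IsStrictOrderedRing N]
  [CanonicallyOrderedAdd N] {S : Set (Set N)}

/-- `Σ⁰₁` comprehension, for one existential quantifier in front of a bounded relation. -/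
def SigmaComprehension (S : Set (Set N)) : Prop :=
  ∀ R : N → N → Prop, (BD S 2 fun v => R (v 1) (v 0)) → {n | ∃ m, R n m} ∈ S

/-- With one free variable, the projection is a set in `S` and can serve as a parameter. With none,
the statement is a constant truth value. With more, two free variables are merged into a pair. -/
theorem RCA0.bd_ex (h : RCA0 S) (hca : SigmaComprehension S) :
    ∀ {k : ℕ} {Q : (Fin (k + 1) → N) → Prop}, BD S (k + 1) Q →
      BD S k fun v => ∃ n, Q (Fin.cons n v)
  | 0, Q, _ =>
    (BD.const (∃ n, Q (Fin.cons n Fin.elim0))).congr fun v => by rw [Subsingleton.elim v]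
  | 1, Q, hQ => by
    have hX := hca (fun y n => Q ![n, y]) (hQ.congr fun v => by
      rw [show ![v 0, v 1] = v from (List.ofFn_inj.1 rfl)])
    refine (BD.mem hX (.proj 0)).congr fun v => exists_congr fun n => ?_
    rw [show (Fin.cons n v : Fin 2 → N) = ![n, v 0] from (List.ofFn_inj.1 rfl)]
  | k + 2, Q, hQ => by
    have hQ' : BD S (k + 2) fun u => ∃ a, a < u 1 + 1 ∧ ∃ b, b < u 1 + 1 ∧ u 1 = pair a b ∧
        Q (Fin.cons (u 0) (Fin.cons a (Fin.cons b fun i => u i.succ.succ))) := by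
      refine .bex (TF.succ (.proj 1)) (.bex (TF.succ (.proj 2)) (.and
        (.eq (.proj 3) (.pair (.proj 1) (.proj 0))) ?_))
      refine (hQ.comp (g := Fin.cons (fun w => w 2) (Fin.cons (fun w => w 1)
        (Fin.cons (fun w => w 0) fun i w => w i.succ.succ.succ.succ))) ?_).congr fun w => ?_
      · exact Fin.cases (.proj 2) (Fin.cases (.proj 1) (Fin.cases (.proj 0) fun i => .proj _))
      · rw [iff_iff_eq]
        congr 1
        exact funext (Fin.cases rfl (Fin.cases rfl (Fin.cases rfl fun i => rfl)))
    refine ((h.bd_ex hca hQ').comp (g := Fin.cons (fun v => pair (v 0) (v 1))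
      fun i v => v i.succ.succ) ?_).congr fun v => ?_
    · exact Fin.cases (.pair (.proj 0) (.proj 1)) fun i => .proj _
    · refine exists_congr fun n => ?_
      have hv : (Fin.cons n v : Fin (k + 3) → N) =
          Fin.cons n (Fin.cons (v 0) (Fin.cons (v 1) fun i => v i.succ.succ)) :=
        funext (Fin.cases rfl (Fin.cases rfl (Fin.cases rfl fun i => rfl)))
      change Q (Fin.cons n v) ↔ ∃ a, a < pair (v 0) (v 1) + 1 ∧ ∃ b, b < pair (v 0) (v 1) + 1 ∧
        pair (v 0) (v 1) = pair a b ∧ Q (Fin.cons n (Fin.cons a (Fin.cons b fun i => v i.succ.succ)))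
      rw [hv]
      constructor
      · exact fun hq => ⟨_, h.lt_add_one_iff.2 (left_le_pair _ _), _,
          h.lt_add_one_iff.2 (h.right_le_pair _ _), rfl, hq⟩
      · rintro ⟨a, -, b, -, hab, hq⟩
        obtain ⟨ha, hb⟩ := h.pair_inj.1 hab
        rwa [ha, hb]

theorem TF.eval (t : Term) {k : ℕ} {f : ℕ → (Fin k → N) → N} (hf : ∀ i, TF k (f i)) :
    TF k fun γ => t.eval fun i => f i γ := by
  induction t with
  | var x => exact hf x
  | zero => exact .const 0
  | one => exact .const 1
  | add s t hs ht => exact hs.add ht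
  | mul s t hs ht => exact hs.mul ht

theorem RCA0.bd_sat (h : RCA0 S) (hca : SigmaComprehension S) {V : ℕ → Set N}
    (hV : ∀ i, V i ∈ S) (φ : ArithFormula) : ∀ {k : ℕ} {f : ℕ → (Fin k → N) → N},
      (∀ i, TF k (f i)) → BD S k fun γ => φ.Sat V fun i => f i γ := by
  have ex : ∀ {φ : ArithFormula} (x : ℕ),
      (∀ {k : ℕ} {f : ℕ → (Fin k → N) → N}, (∀ i, TF k (f i)) →
        BD S k fun γ => φ.Sat V fun i => f i γ) →
      ∀ {k : ℕ} {f : ℕ → (Fin k → N) → N}, (∀ i, TF k (f i)) →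
        BD S k fun γ => ∃ n, φ.Sat V (Function.update (fun i => f i γ) x n) := by
    intro φ x ih k f hf
    refine (h.bd_ex hca (ih (f := Function.update (fun i w => f i (Fin.tail w)) x fun w => w 0)
      fun i => ?_)).congr fun γ => exists_congr fun n => ?_
    · by_cases hi : i = x
      · subst hi; rw [Function.update_self]; exact .proj 0
      · rw [Function.update_of_ne hi]; exact (hf i).weaken
    · rw [iff_iff_eq]
      congr 1
      funext i
      by_cases hi : i = x
      · subst hi; simp
      · simp [Function.update_of_ne hi]
  induction φ with
  | eq s t => exact fun hf => .eq (.eval s hf) (.eval t hf)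
  | lt s t => exact fun hf => .lt (.eval s hf) (.eval t hf)
  | mem t X => exact fun hf => .mem (hV X) (.eval t hf)
  | neg _ ih => exact fun hf => (ih hf).not
  | and _ _ ih₁ ih₂ => exact fun hf => (ih₁ hf).and (ih₂ hf)
  | or _ _ ih₁ ih₂ => exact fun hf => (ih₁ hf).or (ih₂ hf)
  | imp _ _ ih₁ ih₂ => exact fun hf => (ih₁ hf).imp (ih₂ hf)
  | all x φ ih =>
    intro k f hf
    refine (ex (φ := .neg φ) x (fun hg => (ih hg).not) hf).not.congr fun γ => ?_
    simp [ArithFormula.Sat]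
  | ex x _ ih => exact ex x ih

theorem RCA0.aca0 (h : RCA0 S) (hS : S.Nonempty) (hca : SigmaComprehension S) : ACA0 S where
  basic := h.basic
  induction X hX := h.induction hS (.mem hX (.proj 0))
  arithmetical_comprehension φ x v V hV := by
    refine ⟨{n | φ.Sat V (Function.update v x n)}, h.comprehension hS ?_, fun n => Iff.rfl⟩
    refine (h.bd_sat hca hV φ (f := Function.update (fun i _ => v i) x fun γ => γ 0)
      fun i => ?_).congr fun γ => ?_
    · by_cases hi : i = x
      · subst hi; rw [Function.update_self]; exact .proj 0
      · rw [Function.update_of_ne hi]; exact .const _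
    · rw [iff_iff_eq]
      congr 1
      funext i
      by_cases hi : i = x
      · subst hi; simp
      · simp [Function.update_of_ne hi]

/-! ### The e-matroid of a Σ⁰₁ set, and the two implications -/

theorem HasCard.exists_mem {A : Set N} {m n : N} (hA : HasCard S A n) (hmn : m < n) :
    ∃ a, a ∈ A := by
  obtain ⟨f, -, ⟨hf, hf'⟩, -⟩ := hA
  obtain ⟨a, ha, -⟩ := hf' m hmn
  obtain ⟨_, -, b, hb, -⟩ := hf _ ha
  exact ⟨b, hb⟩

/-- For exchange, the cardinality hypothesis serves only to make `y` nonempty: every element of the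
independent `y` avoids `A`, so adding it to `x` creates no dependence. -/
theorem dependenceAxioms_of_meets (M A : Set N) :
    DependenceAxioms S M {c | c ∈ finSubsets M ∧ ∃ x ∈ decode c, x ∈ A} where
  empty := fun c ⟨_, x, hx, _⟩ hc => by rw [hc] at hx; exact hx
  superset := fun c ⟨_, x, hx, hxA⟩ d hd hcd => ⟨hd, x, hcd hx, hxA⟩
  exchange := by
    rintro x hx y hy ⟨m, n, -, hn, hmn⟩ hxD hyD
    obtain ⟨a, ha⟩ := hn.exists_mem hmn
    refine ⟨a, ha, ?_⟩
    rintro z ⟨-, b, hb, hbA⟩ hz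
    rw [hz] at hb
    rcases hb with hb | rfl
    · exact hxD ⟨hx, b, hb, hbA⟩
    · exact hyD ⟨hy, b, ha, hbA⟩

/-- If `A` is `Σ⁰₁`-definable and nonempty, then the finite sets that meet `A` are the values of
an e-matroid. -/
theorem RCA0.exists_eMatroid (h : RCA0 S) (hS : S.Nonempty) {R : N → N → Prop}
    (hR : BD S 2 fun v => R (v 1) (v 0)) {x₀ z₀ : N} (h₀ : R x₀ z₀) :
    ∃ e ∈ S, IsEMatroid S Set.univ e ∧
      ∀ c, IsFinCode c → ((∃ n, pair n c ∈ e) ↔ ∃ x ∈ decode c, ∃ z, R x z) := by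
  obtain ⟨c₀, hc₀, hc₀x⟩ := h.exists_singleton_code hS x₀
  -- At stage `n = (z, c)`, the code `c` is listed if `z` witnesses that some element of its set is
  -- in `A`.
  let G : N → N → Prop := fun n c => IsFinCode c ∧ ∃ z, z < n + 1 ∧ n = pair z c ∧
    ∃ x, x < c ∧ x ∈ decode c ∧ R x z
  -- Stages that list nothing take the default `c₀`, the code of `{x₀}`, which is itself dependent.
  -- The bound `n + 1` loses nothing by `hGlt`.
  let E : N → N → Prop := fun n c => G n c ∨ (c = c₀ ∧ ∀ c', c' < n + 1 → ¬ G n c')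
  have hG : ∀ {k : ℕ} {f g : (Fin k → N) → N}, TF k f → TF k g →
      BD S k fun v => G (f v) (g v) := fun {k f g} hf hg => by
    refine .and (h.bd_isFinCode hg) (.bex hf.succ (.and (.eq hf.weaken (.pair (.proj 0) hg.weaken))
      (.bex hg.weaken (.and (h.bd_mem_decode (.proj 0) hg.weaken.weaken) ?_))))
    exact hR.comp (g := ![fun w => w 1, fun w => w 0])
      (Fin.cases (.proj 1) (Fin.cases (.proj 0) fun i => i.elim0))
  have hGlt : ∀ {n c}, G n c → c < n + 1 := fun ⟨_, _, _, hn, _⟩ =>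
    h.lt_add_one_iff.2 (hn ▸ h.right_le_pair _ _)
  have hGuniq : ∀ {n c c'}, G n c → G n c' → c = c' := fun ⟨_, _, _, hn, _⟩ ⟨_, _, _, hn', _⟩ =>
    (h.pair_inj.1 (hn.symm.trans hn')).2
  have hE : ∀ c, (∃ n, E n c) ↔ IsFinCode c ∧ ∃ x ∈ decode c, ∃ z, R x z := by
    intro c
    constructor
    · rintro ⟨n, ⟨hc, z, -, -, x, -, hx, hxz⟩ | ⟨rfl, -⟩⟩
      · exact ⟨hc, x, hx, z, hxz⟩
      · exact ⟨hc₀, x₀, by rw [hc₀x]; rfl, z₀, h₀⟩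
    · rintro ⟨hc, x, hx, z, hxz⟩
      exact ⟨pair z c, Or.inl ⟨hc, z, h.lt_add_one_iff.2 (left_le_pair _ _), rfl, x,
        h.lt_of_mem_decode hx, hx, hxz⟩⟩
  let e : Set N := {p | ∃ n, n < p + 1 ∧ ∃ c, c < p + 1 ∧ p = pair n c ∧ E n c}
  have he : ∀ n c, pair n c ∈ e ↔ E n c := by
    intro n c
    constructor
    · rintro ⟨n', -, c', -, hp, hE⟩
      obtain ⟨rfl, rfl⟩ := h.pair_inj.1 hp
      exact hE
    · exact fun hE => ⟨n, h.lt_add_one_iff.2 (left_le_pair _ _), c,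
        h.lt_add_one_iff.2 (h.right_le_pair _ _), rfl, hE⟩
  have heS : e ∈ S := by
    refine h.comprehension hS (.bex (TF.succ (.proj 0)) (.bex (TF.succ (.proj 1))
      (.and (.eq (.proj 2) (.pair (.proj 1) (.proj 0))) (.or (hG (.proj 1) (.proj 0))
        (.and (.eq (.proj 0) (.const _)) (.ball (TF.succ (.proj 1))
          (.not (hG (.proj 2) (.proj 0)))))))))
  have huniv : Set.univ ∈ S := by
    have := h.comprehension hS (P := fun _ => True) (.const _)
    rwa [Set.ofPred_true] at this
  refine ⟨e, heS, ⟨huniv, heS, ⟨?_, ?_⟩, ?_⟩, fun c hc => ?_⟩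
  · rintro p ⟨n, -, c, -, rfl, hEc⟩
    exact ⟨n, trivial, c, ⟨((hE c).1 ⟨n, hEc⟩).1, Set.subset_univ _⟩, rfl⟩
  · intro n _
    simp only [he]
    by_cases hn : ∃ c, G n c
    · obtain ⟨c, hc⟩ := hn
      refine ⟨c, Or.inl hc, ?_⟩
      rintro c' (hc' | ⟨-, hc'⟩)
      · exact hGuniq hc' hc
      · exact (hc' c (hGlt hc) hc).elim
    · push Not at hn
      refine ⟨c₀, Or.inr ⟨rfl, fun c _ => hn c⟩, ?_⟩
      rintro c' (hc' | ⟨hc', -⟩)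
      · exact (hn _ hc').elim
      · exact hc'
  · have := dependenceAxioms_of_meets (S := S) Set.univ {x | ∃ z, R x z}
    simpa only [he, hE, finSubsets, Set.mem_ofPred_eq, Set.subset_univ, and_true] using this
  · simp only [he, hE, hc, true_and]

theorem RCA0.sigmaComprehension (h : RCA0 S) (hS : S.Nonempty)
    (hiso : EveryEMatroidIsoMatroid S) : SigmaComprehension S := by
  intro R hR
  by_cases hne : ∃ x z, R x z
  swap
  · have := h.comprehension hS (P := fun n => ∃ m, R n m)
      ((BD.const False).congr fun v => iff_of_false (fun hv => hne ⟨_, hv⟩) id)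
    exact this
  obtain ⟨x₀, z₀, h₀⟩ := hne
  obtain ⟨e, heS, hE, he⟩ := h.exists_eMatroid hS hR h₀
  obtain ⟨M', -, D, hD, g, hg, hMD, ⟨⟨-, hfun⟩, -⟩, hDe⟩ := hiso _ hE.ground_mem e heS hE
  -- The Π⁰₁ form says that every code of `{h(n)}` lies in `D`; the single variable `m` bounds both
  -- the code `d` and the image `b`.
  refine h.delta_comprehension hS (R' := fun n m => ∀ d, d < m → ∀ b, b < m → pair n b ∈ g →
    IsFinCode d → b ∈ decode d → (∀ i, i < d → i ∈ decode d → i = b) → d ∈ D) hR ?_ fun n => ?_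
  · exact .ball (.proj 0) (.ball (.proj 1) (.imp (.mem hg (.pair (.proj 3) (.proj 0)))
      (.imp (h.bd_isFinCode (.proj 1)) (.imp (h.bd_mem_decode (.proj 0) (.proj 1))
        (.imp (.ball (.proj 1) (.imp (h.bd_mem_decode (.proj 0) (.proj 2))
          (.eq (.proj 0) (.proj 1)))) (.mem hD (.proj 1)))))))
  obtain ⟨c, hc, hcn⟩ := h.exists_singleton_code hS n
  obtain ⟨b₀, hb₀, hb₀'⟩ := hfun n trivial
  have key : (∃ m, R n m) ↔ ∃ d ∈ D, decode d = {b₀} := by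
    have h₁ := he c hc
    have h₂ := hDe c ⟨hc, Set.subset_univ _⟩
    have himage : {b | ∃ a ∈ decode c, pair a b ∈ g} = {b₀} := by
      ext b
      simp only [hcn, Set.mem_singleton_iff, exists_eq_left, Set.mem_ofPred_eq]
      exact ⟨hb₀' b, fun hb => hb ▸ hb₀⟩
    rw [himage] at h₂
    rw [← h₂, h₁, hcn]
    simp
  rw [key]
  constructor
  · rintro ⟨d, hdD, hd⟩ m d' - b - hb hd' hbd' huniq
    have hbb := hb₀' b hb
    have : d' = d := hd'.eq_of_decode_eq (hMD.subset hdD).1 <| by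
      rw [hd]
      ext i
      rw [Set.mem_singleton_iff, ← hbb]
      exact ⟨fun hi => huniq i (h.lt_of_mem_decode hi) hi, fun hi => hi ▸ hbd'⟩
    rwa [this]
  · intro H
    obtain ⟨d, hd, hdb⟩ := h.exists_singleton_code hS b₀
    exact ⟨d, H (d + b₀ + 1) d (h.lt_add_one_iff.2 le_self_add) b₀
      (h.lt_add_one_iff.2 le_add_self) hb₀ hd (by rw [hdb]; rfl)
      (fun i _ hi => by rwa [hdb] at hi), hdb⟩

theorem RCA0.everyEMatroidIsoMatroid (h : RCA0 S) (hS : S.Nonempty) (haca : ACA0 S) :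
    EveryEMatroidIsoMatroid S := by
  intro M hM e heS he
  -- The formula is `∃ n, pair n c ∈ e`, with `n` as variable `1` and `c` as variable `0`.
  obtain ⟨D, hD, hDe⟩ := haca.arithmetical_comprehension
    (.ex 1 (.mem (.add (.mul (.add (.var 1) (.var 0)) (.add (.var 1) (.var 0))) (.var 1)) 0))
    0 (fun _ => 0) (fun _ => e) fun _ => heS
  have hDe' : D = {c | ∃ n, pair n c ∈ e} := by
    ext c
    rw [hDe]
    simp [ArithFormula.Sat, Term.eval, pair]
  let g : Set N := {p | ∃ a, a < p + 1 ∧ a ∈ M ∧ p = pair a a}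
  have hg : ∀ a b, pair a b ∈ g ↔ a ∈ M ∧ b = a := by
    intro a b
    constructor
    · rintro ⟨c, -, hc, hp⟩
      obtain ⟨rfl, rfl⟩ := h.pair_inj.1 hp
      exact ⟨hc, rfl⟩
    · rintro ⟨ha, rfl⟩
      exact ⟨b, h.lt_add_one_iff.2 (left_le_pair _ _), ha, rfl⟩
  have hgS : g ∈ S := h.comprehension hS (.bex (TF.succ (.proj 0)) (.and (.mem hM (.proj 0))
    (.eq (.proj 1) (.pair (.proj 0) (.proj 0)))))
  have hsub : D ⊆ finSubsets M := by
    rw [hDe']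
    rintro c ⟨n, hn⟩
    obtain ⟨_, -, c', hc', hp⟩ := he.isFun.1 _ hn
    rwa [(h.pair_inj.1 hp).2]
  refine ⟨M, hM, D, hD, g, hgS, ⟨hM, hD, hsub, hDe' ▸ he.axioms⟩, ⟨⟨?_, ?_⟩, ?_⟩, ?_⟩
  · rintro p ⟨a, -, ha, rfl⟩
    exact ⟨a, ha, a, ha, rfl⟩
  · exact fun a ha => ⟨a, (hg a a).2 ⟨ha, rfl⟩, fun b hb => ((hg a b).1 hb).2⟩
  · exact fun b hb => ⟨b, (hg b b).2 ⟨hb, rfl⟩, fun a ha => ((hg a b).1 ha).2.symm⟩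
  · intro x hx
    have himage : {b | ∃ a ∈ decode x, pair a b ∈ g} = decode x := by
      ext b
      simp only [hg, Set.mem_ofPred_eq]
      exact ⟨fun ⟨a, ha, _, hb⟩ => hb ▸ ha, fun hb => ⟨b, hb, hx.2 hb, rfl⟩⟩
    rw [himage]
    have hxD : (∃ n, pair n x ∈ e) ↔ x ∈ D := by rw [hDe']; rfl
    rw [hxD]
    refine ⟨fun hxD => ⟨x, hxD, rfl⟩, fun ⟨d, hd, hdx⟩ => ?_⟩
    rwa [← (hsub hd).1.eq_of_decode_eq hx.1 hdx]

theorem RCA0.aca0_iff (h : RCA0 S) (hS : S.Nonempty) : ACA0 S ↔ EveryEMatroidIsoMatroid S :=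
  ⟨h.everyEMatroidIsoMatroid hS, fun hiso => h.aca0 hS (h.sigmaComprehension hS hiso)⟩

end Equivalence

end SOA

theorem mainTheorem9 {N : Type u} [Zero N] [One N] [Add N] [Mul N] [LT N]
    (S : Set (Set N)) (hS : S.Nonempty) (hRCA : SOA.RCA0 S) :
    SOA.ACA0 S ↔ SOA.EveryEMatroidIsoMatroid S := by
  let i₁ : CommSemiring N := hRCA.commSemiring hS
  -- The constructed instances reuse the given operations and order, so the hypothesis transfers
  -- definitionally.
  have h₁ : @SOA.RCA0 N i₁.toZero i₁.toOne i₁.toAdd i₁.toMul _ S := hRCA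
  let i₂ : LinearOrder N := h₁.linearOrder hS
  have h₂ : @SOA.RCA0 N i₁.toZero i₁.toOne i₁.toAdd i₁.toMul i₂.toLT S := hRCA
  have i₃ : IsStrictOrderedRing N := h₂.isStrictOrderedRing hS
  have i₄ : CanonicallyOrderedAdd N := h₂.canonicallyOrderedAdd hS
  exact @SOA.RCA0.aca0_iff N i₁ i₂ i₃ i₄ S h₂ hS
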